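/- Theorem 1. All rings are commutative Noetherian local rings and all modules are finitely generated. For such a ring $R$ with maximal ideal $\mathfrak m$ and a non-zero $R$-module $M$, let $\operatorname{depth} M$ be the supremum of the lengths of the $M$-regular sequences in $\mathfrak m$; $R$ is Cohen–Macaulay if $\operatorname{depth} R$ equals the Krull dimension of $R$. Two $R$-modules $M, N$ are Tor-independent if $\operatorname{Tor}_i^R(M,N)=0$ for all $i\ge 1$, and the pair $(M,N)$ satisfies the depth formula if $$\operatorname{depth} M+\operatorname{depth} N=\operatorname{depth} R+\operatorname{depth}(M\otimes_R N).$$ Suppose that for every Cohen–Macaulay local ring $R$ of Krull dimension $1$, every pair of non-zero Tor-independent $R$-modules satisfies the depth formula. Then for every Cohen–Macaulay local ring $R$, every pair of non-zero Tor-independent $R$-modules satisfies the depth formula. -/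

import Mathlib

open CategoryTheory
open scoped TensorProduct

universe u v

/-- The depth of a module `M` over a local ring `R`: the supremum of the lengths of the
`M`-regular sequences contained in the maximal ideal. (Regular sequences `x₁, …, xₙ` are required
to satisfy `(x₁, …, xₙ) M ≠ M`; the notion is only used for non-zero modules.) -/
noncomputable def moduleDepth (R : Type u) [CommRing R] [IsLocalRing R]
    (M : Type v) [AddCommGroup M] [Module R M] : ℕ∞ :=
  ⨆ (rs : List R) (_ : ∀ r ∈ rs, r ∈ IsLocalRing.maximalIdeal R)
    (_ : RingTheory.Sequence.IsRegular M rs), (rs.length : ℕ∞)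

/-- A local ring is Cohen–Macaulay if it is Noetherian and its depth equals its Krull
dimension. -/
structure IsCohenMacaulayLocalRing (R : Type u) [CommRing R] [IsLocalRing R] : Prop where
  isNoetherianRing : IsNoetherianRing R
  depth_eq_dim : (moduleDepth R R : WithBot ℕ∞) = ringKrullDim R

/-- Two modules `M`, `N` over `R` are Tor-independent if `Tor_i^R(M, N) = 0` for all `i ≥ 1`. -/
def TorIndependent (R : Type u) [CommRing R] (M N : Type u) [AddCommGroup M] [Module R M]
    [AddCommGroup N] [Module R N] : Prop :=
  ∀ i : ℕ, 1 ≤ i →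
    Limits.IsZero (((Tor (ModuleCat.{u} R) i).obj (ModuleCat.of R M)).obj (ModuleCat.of R N))

/-- The pair `(M, N)` satisfies Auslander's depth formula
`depth M + depth N = depth R + depth (M ⊗ N)`. -/
def SatisfiesDepthFormula (R : Type u) [CommRing R] [IsLocalRing R] (M N : Type u)
    [AddCommGroup M] [Module R M] [AddCommGroup N] [Module R N] : Prop :=
  moduleDepth R M + moduleDepth R N = moduleDepth R R + moduleDepth R (M ⊗[R] N)

/-- The depth formula holds over `R` for all pairs of non-zero, finitely generated,
Tor-independent modules. -/
def DepthFormulaHoldsOver (R : Type u) [CommRing R] [IsLocalRing R] : Prop :=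
  ∀ (M N : Type u) [AddCommGroup M] [Module R M] [AddCommGroup N] [Module R N],
    Module.Finite R M → Module.Finite R N → Nontrivial M → Nontrivial N →
      TorIndependent R M N → SatisfiesDepthFormula R M N

/-!
The proof is by induction on the dimension `d` of `R`. For `d = 0` every finite module has depth
zero, and `d = 1` is the hypothesis. Let `d ≥ 2`, and let `M`, `N` be Tor-independent.

If `M`, `N` and `M ⊗ N` all have positive depth, some `x ∈ 𝔪` is regular on `R`, `M`, `N` and
`M ⊗ N`; then `M/xM` and `N/xN` are Tor-independent over the Cohen-Macaulay ring `R/(x)`, and the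
formula follows by induction (`satisfiesDepthFormula_of_moduleDepth_tensor_ne_zero`). The remaining
cases are reduced to this one through first syzygies:

* If `M` and `N` have positive depth but `M ⊗ N` has depth zero, let `0 → K → F → M → 0` be a free
  presentation. Then `K` and `N` are Tor-independent and `0 → K ⊗ N → F ⊗ N → M ⊗ N → 0` is exact,
  so `depth (K ⊗ N) = 1` and `depth K + depth N = d + 1`. If `depth M < d`, then
  `depth K = depth M + 1` and the formula follows; otherwise `depth N = 1 < d`, and `M` and `N` may
  be exchanged.
* If `depth M > 0` and `depth N = 0`, the first syzygy `K` of `N` has depth one, and the formula for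
  `M` and `K` forces `depth M = d` and `depth (M ⊗ N) = 0`.
* If `depth M = depth N = 0`, the previous case applied to the first syzygy of `M`, which has depth
  one, forces `d = 1`.

Depth is handled through the Rees theorem: `n ≤ depth M` means `Ext^i(R/𝔪, M) = 0` for `i < n`
(`le_moduleDepth_iff`), so that the depth lemma comes from the long exact sequence. Tor is handled
through `torIndependent_iff`: for a presentation `0 → K → G → N → 0` with `G` projective,
Tor-independence of `M` and `N` is injectivity of `M ⊗ K → M ⊗ G` together with Tor-independence of
`M` and `K`. Symmetry, syzygies in the first variable, and reduction modulo a regular element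
follow from this by induction on the degree.
-/

/-! ### Dimension shifting for left derived functors and Tor -/

namespace CategoryTheory.ProjectiveResolution

variable {C : Type*} [Category* C] [Abelian C]

/-- The augmentation `P₀ ⟶ X` of a projective resolution of `X`, with target literally `X`. -/
noncomputable def augmentation {X : C} (P : ProjectiveResolution X) : P.complex.X 0 ⟶ X :=
  P.π.f 0

instance {X : C} (P : ProjectiveResolution X) : Epi P.augmentation :=
  inferInstanceAs (Epi (P.π.f 0))

lemma d_comp_augmentation {X : C} (P : ProjectiveResolution X) :
    P.complex.d 1 0 ≫ P.augmentation = 0 :=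
  P.complex_d_comp_π_f_zero

lemma exact_augmentation {X : C} (P : ProjectiveResolution X) :
    (ShortComplex.mk _ _ P.d_comp_augmentation).Exact :=
  P.exact₀

variable {S : ShortComplex C}

lemma d_comp_augmentation_comp (P : ProjectiveResolution S.X₁) :
    P.complex.d 1 0 ≫ P.augmentation ≫ S.f = 0 := by
  rw [← Category.assoc, P.d_comp_augmentation, Limits.zero_comp]

/-- Given a short exact sequence `0 ⟶ X₁ ⟶ X₂ ⟶ X₃ ⟶ 0` with `X₂` projective, the projective
resolution of `X₃` obtained by prepending `X₂` to a projective resolution of `X₁`. -/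
noncomputable def splice (hS : S.ShortExact) [Projective S.X₂] (P : ProjectiveResolution S.X₁) :
    ProjectiveResolution S.X₃ where
  complex := P.complex.augment (P.augmentation ≫ S.f) P.d_comp_augmentation_comp
  projective n := by
    cases n with
    | zero => exact inferInstanceAs (Projective S.X₂)
    | succ n => exact P.projective n
  π := (ChainComplex.toSingle₀Equiv _ _).symm ⟨S.g, by
    change (P.augmentation ≫ S.f) ≫ S.g = 0
    rw [Category.assoc, S.zero, Limits.comp_zero]⟩
  quasiIso := ⟨fun n => by
    have := hS.mono_f
    have := hS.epi_g
    have w : (P.augmentation ≫ S.f) ≫ S.g = 0 := by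
      rw [Category.assoc, S.zero, Limits.comp_zero]
    match n with
    | 0 =>
      rw [ChainComplex.quasiIsoAt₀_iff, ShortComplex.quasiIso_iff_of_zeros']
      · let φ : ShortComplex.mk (P.augmentation ≫ S.f) S.g w ⟶ S :=
          { τ₁ := P.augmentation, τ₂ := 𝟙 _, τ₃ := 𝟙 _ }
        have : Epi φ.τ₁ := inferInstanceAs (Epi P.augmentation)
        have : IsIso φ.τ₂ := inferInstanceAs (IsIso (𝟙 _))
        have : Mono φ.τ₃ := inferInstanceAs (Mono (𝟙 _))
        refine (ShortComplex.exact_and_epi_g_iff_of_iso ?_).2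
          ⟨(ShortComplex.exact_iff_of_epi_of_isIso_of_mono φ).2 hS.exact, hS.epi_g⟩
        refine ShortComplex.isoMk (Iso.refl _) (Iso.refl _) (Iso.refl _)
          ((Category.id_comp _).trans (Category.comp_id _).symm) ?_
        refine (Category.id_comp _).trans (Eq.trans ?_ (Category.comp_id _).symm)
        exact (ChainComplex.toSingle₀Equiv_symm_apply_f_zero
          (C := P.complex.augment (P.augmentation ≫ S.f) P.d_comp_augmentation_comp) S.g w).symm
      all_goals rfl
    | 1 =>
      rw [quasiIsoAt_iff_exactAt']
      · rw [HomologicalComplex.exactAt_iff' _ 2 1 0 (by simp) (by simp)]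
        let φ : ShortComplex.mk _ _ P.d_comp_augmentation ⟶
            ShortComplex.mk _ _ P.d_comp_augmentation_comp :=
          { τ₁ := 𝟙 _, τ₂ := 𝟙 _, τ₃ := S.f }
        have : Epi φ.τ₁ := inferInstanceAs (Epi (𝟙 _))
        have : IsIso φ.τ₂ := inferInstanceAs (IsIso (𝟙 _))
        have : Mono φ.τ₃ := inferInstanceAs (Mono S.f)
        exact (ShortComplex.exact_iff_of_epi_of_isIso_of_mono φ).1 P.exact_augmentation
      · apply ChainComplex.exactAt_succ_single_obj
    | n + 2 =>
      rw [quasiIsoAt_iff_exactAt']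
      · rw [HomologicalComplex.exactAt_iff' _ (n + 3) (n + 2) (n + 1) (by simp) (by simp)]
        exact P.exact_succ n
      · apply ChainComplex.exactAt_succ_single_obj⟩

end CategoryTheory.ProjectiveResolution

section LeftDerived

variable {C : Type*} [Category* C] [Abelian C] [HasProjectiveResolutions C]
  {D : Type*} [Category* D] [Abelian D] (F : C ⥤ D) [F.Additive]

/-- Vanishing of a derived functor, read off as exactness at one spot of any resolution. -/
lemma CategoryTheory.ProjectiveResolution.isZero_leftDerived_succ_iff {X : C}
    (P : ProjectiveResolution X) (n : ℕ) :
    Limits.IsZero ((F.leftDerived (n + 1)).obj X) ↔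
      (ShortComplex.mk (F.map (P.complex.d (n + 2) (n + 1))) (F.map (P.complex.d (n + 1) n)) (by
        rw [← F.map_comp, P.complex.d_comp_d, F.map_zero])).Exact := by
  rw [(P.isoLeftDerivedObj F (n + 1)).isZero_iff]
  change Limits.IsZero (((F.mapHomologicalComplex _).obj P.complex).homology (n + 1)) ↔ _
  rw [← HomologicalComplex.exactAt_iff_isZero_homology,
    HomologicalComplex.exactAt_iff' _ (n + 2) (n + 1) n (by simp) (by simp)]
  rfl

/-- Dimension shifting: the resolution spliced from one of `X₁` has the same differentials, one
degree higher. -/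
lemma CategoryTheory.Functor.isZero_leftDerived_add_two_iff {S : ShortComplex C}
    (hS : S.ShortExact) [Projective S.X₂] (n : ℕ) :
    Limits.IsZero ((F.leftDerived (n + 2)).obj S.X₃) ↔
      Limits.IsZero ((F.leftDerived (n + 1)).obj S.X₁) := by
  rw [((projectiveResolution S.X₁).splice hS).isZero_leftDerived_succ_iff F,
    (projectiveResolution S.X₁).isZero_leftDerived_succ_iff F]
  rfl

lemma CategoryTheory.Functor.isZero_leftDerived_one_iff [Limits.PreservesFiniteColimits F]
    {S : ShortComplex C} (hS : S.ShortExact) [Projective S.X₂] :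
    Limits.IsZero ((F.leftDerived 1).obj S.X₃) ↔ Mono (F.map S.f) := by
  let P := projectiveResolution S.X₁
  rw [(P.splice hS).isZero_leftDerived_succ_iff F]
  have w : F.map (P.complex.d 1 0) ≫ F.map (P.augmentation ≫ S.f) = 0 := by
    rw [← F.map_comp, P.d_comp_augmentation_comp, F.map_zero]
  change (ShortComplex.mk (F.map (P.complex.d 1 0)) (F.map (P.augmentation ≫ S.f)) w).Exact ↔ _
  have ex : ((ShortComplex.mk _ _ P.d_comp_augmentation).map F).Exact ∧
      Epi ((ShortComplex.mk _ _ P.d_comp_augmentation).map F).g :=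
    (ShortComplex.exact_and_epi_g_iff_g_is_cokernel _).2
      ⟨Limits.CokernelCofork.mapIsColimit _ P.isColimitCokernelCofork F⟩
  have w₀ : F.map (P.complex.d 1 0) ≫ F.map P.augmentation = 0 := by
    rw [← F.map_comp, P.d_comp_augmentation, F.map_zero]
  obtain ⟨ex, epi⟩ : (ShortComplex.mk _ _ w₀).Exact ∧ Epi (F.map P.augmentation) := ex
  constructor
  · intro h
    rw [Preadditive.mono_iff_cancel_zero]
    intro T z hz
    obtain ⟨T', π, hπ, y, hy⟩ := surjective_up_to_refinements_of_epi (F.map P.augmentation) z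
    obtain ⟨T'', π', hπ', w, hw⟩ := h.exact_up_to_refinements y (by
      change y ≫ F.map (P.augmentation ≫ S.f) = 0
      rw [F.map_comp, ← Category.assoc, ← hy, Category.assoc, hz, Limits.comp_zero])
    rw [← cancel_epi π, ← cancel_epi π', hy, ← Category.assoc, hw]
    change (w ≫ F.map (P.complex.d 1 0)) ≫ _ = _
    rw [Category.assoc, ← F.map_comp, P.d_comp_augmentation]
    simp
  · intro h
    let φ : ShortComplex.mk _ _ w₀ ⟶
        ShortComplex.mk (F.map (P.complex.d 1 0)) (F.map (P.augmentation ≫ S.f)) w :=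
      { τ₁ := 𝟙 _, τ₂ := 𝟙 _, τ₃ := F.map S.f, comm₂₃ := by simp }
    have : Epi φ.τ₁ := inferInstanceAs (Epi (𝟙 _))
    have : IsIso φ.τ₂ := inferInstanceAs (IsIso (𝟙 _))
    have : Mono φ.τ₃ := inferInstanceAs (Mono (F.map S.f))
    exact (ShortComplex.exact_iff_of_epi_of_isIso_of_mono φ).1 ex

end LeftDerived

section Tor

open MonoidalCategory

variable {R : Type u} [CommRing R] {M N K G : Type u} [AddCommGroup M] [Module R M]
  [AddCommGroup N] [Module R N] [AddCommGroup K] [Module R K] [AddCommGroup G] [Module R G]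

/-- The `i`-th Tor module of `M` and `N` vanishes. -/
abbrev TorVanishes (R : Type u) [CommRing R] (i : ℕ) (M N : Type u) [AddCommGroup M] [Module R M]
    [AddCommGroup N] [Module R N] : Prop :=
  Limits.IsZero (((Tor (ModuleCat.{u} R) i).obj (ModuleCat.of R M)).obj (ModuleCat.of R N))

lemma shortExact_of_exact {f : K →ₗ[R] G} {g : G →ₗ[R] N} (hf : Function.Injective f)
    (hfg : Function.Exact f g) (hg : Function.Surjective g) :
    (ShortComplex.mk (ModuleCat.ofHom f) (ModuleCat.ofHom g) (by
      ext x; exact hfg.apply_apply_eq_zero x)).ShortExact where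
  exact := (ShortComplex.ShortExact.moduleCat_exact_iff_function_exact _).2 hfg
  mono_f := (ModuleCat.mono_iff_injective _).2 hf
  epi_g := (ModuleCat.epi_iff_surjective _).2 hg

variable (M) in
lemma torVanishes_add_two_iff [Module.Projective R G] {f : K →ₗ[R] G} {g : G →ₗ[R] N}
    (hf : Function.Injective f) (hfg : Function.Exact f g) (hg : Function.Surjective g) (i : ℕ) :
    TorVanishes R (i + 2) M N ↔ TorVanishes R (i + 1) M K := by
  have : Projective (ModuleCat.of R G) := inferInstance
  exact Functor.isZero_leftDerived_add_two_iff _ (shortExact_of_exact hf hfg hg) i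

variable (M) in
lemma torVanishes_one_iff [Module.Projective R G] {f : K →ₗ[R] G} {g : G →ₗ[R] N}
    (hf : Function.Injective f) (hfg : Function.Exact f g) (hg : Function.Surjective g) :
    TorVanishes R 1 M N ↔ Function.Injective (f.lTensor M) := by
  have : Projective (ModuleCat.of R G) := inferInstance
  have : Limits.PreservesFiniteColimits
    ((tensoringLeft (ModuleCat.{u} R)).obj (ModuleCat.of R M)) := inferInstance
  refine (Functor.isZero_leftDerived_one_iff _ (shortExact_of_exact hf hfg hg)).trans ?_
  rw [ModuleCat.mono_iff_injective]
  rfl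

/-- Tor-independence in terms of a syzygy in the second variable. This is the only form in which
the derived functors enter below. -/
lemma torIndependent_iff [Module.Projective R G] {f : K →ₗ[R] G} {g : G →ₗ[R] N}
    (hf : Function.Injective f) (hfg : Function.Exact f g) (hg : Function.Surjective g) :
    TorIndependent R M N ↔ Function.Injective (f.lTensor M) ∧ TorIndependent R M K := by
  rw [← torVanishes_one_iff M hf hfg hg]
  constructor
  · refine fun h => ⟨h 1 le_rfl, fun i hi => ?_⟩
    obtain ⟨i, rfl⟩ := Nat.exists_eq_add_of_le' hi
    exact (torVanishes_add_two_iff M hf hfg hg i).1 (h (i + 2) (by omega))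
  · rintro ⟨h1, h⟩ i hi
    match i, hi with
    | 1, _ => exact h1
    | i + 2, _ => exact (torVanishes_add_two_iff M hf hfg hg i).2 (h (i + 1) (by omega))

end Tor

/-! ### Tor-independence: symmetry, syzygies and reduction modulo a regular element -/

section TensorSnake
variable {R : Type*} [CommRing R] {M' F M N' G N : Type*}
  [AddCommGroup M'] [Module R M'] [AddCommGroup F] [Module R F] [AddCommGroup M] [Module R M]
  [AddCommGroup N'] [Module R N'] [AddCommGroup G] [Module R G] [AddCommGroup N] [Module R N]

lemma LinearMap.rTensor_lTensor_apply (a : M' →ₗ[R] F) (b : N' →ₗ[R] G) (x : M' ⊗[R] N') :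
    a.rTensor G (b.lTensor M' x) = b.lTensor F (a.rTensor N' x) := by
  rw [← LinearMap.comp_apply, ← LinearMap.comp_apply, LinearMap.rTensor_comp_lTensor,
    LinearMap.lTensor_comp_rTensor]

/-- Balancing of `Tor₁`: for exact `M' → F → M → 0` and `N' → G → N → 0` with `M' → F` injective and
`G` flat, if `M ⊗ N' → M ⊗ G` is injective then so is `M' ⊗ N → F ⊗ N`. The proof is a diagram chase
in the `3 × 3` diagram of tensor products. -/
lemma rTensor_injective_of_lTensor_injective [Module.Flat R G] {i : M' →ₗ[R] F} {p : F →ₗ[R] M}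
    (hi : Function.Injective i) (hip : Function.Exact i p) (hp : Function.Surjective p)
    {j : N' →ₗ[R] G} {q : G →ₗ[R] N} (hjq : Function.Exact j q) (hq : Function.Surjective q)
    (h : Function.Injective (j.lTensor M)) : Function.Injective (i.rTensor N) := by
  rw [injective_iff_map_eq_zero]
  intro z hz
  obtain ⟨w, rfl⟩ := LinearMap.lTensor_surjective M' hq z
  rw [LinearMap.rTensor_lTensor_apply] at hz
  -- `w : M' ⊗ G` lifts `z`, and `v : F ⊗ N'` has the same image as `w` in `F ⊗ G`.
  obtain ⟨v, hv⟩ := (lTensor_exact F hjq hq _).1 hz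
  have hv' : p.rTensor N' v = 0 := by
    apply h
    rw [map_zero, ← LinearMap.rTensor_lTensor_apply, hv, ← LinearMap.comp_apply,
      ← LinearMap.rTensor_comp, hip.linearMap_comp_eq_zero, LinearMap.rTensor_zero,
      LinearMap.zero_apply]
  obtain ⟨y, rfl⟩ := (rTensor_exact N' hip hp _).1 hv'
  have hy : w = j.lTensor M' y :=
    Module.Flat.rTensor_preserves_injective_linearMap i hi (by
      rw [← hv, LinearMap.rTensor_lTensor_apply])
  rw [hy]
  exact (lTensor_exact M' hjq hq).apply_apply_eq_zero y

end TensorSnake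

section TorIndependent

variable {R : Type u} [CommRing R]

lemma exists_free_presentation (N : Type u) [AddCommGroup N] [Module R N] :
    ∃ (K : Type u) (_ : AddCommGroup K) (_ : Module R K) (j : K →ₗ[R] (N →₀ R))
      (q : (N →₀ R) →ₗ[R] N),
      Function.Injective j ∧ Function.Exact j q ∧ Function.Surjective q :=
  ⟨LinearMap.ker (Finsupp.linearCombination R id), inferInstance, inferInstance,
    Submodule.subtype _, Finsupp.linearCombination R id, Submodule.subtype_injective _,
    LinearMap.exact_subtype_ker_map _, Finsupp.linearCombination_id_surjective R N⟩

variable {M N M' F : Type u} [AddCommGroup M] [Module R M] [AddCommGroup N] [Module R N]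
  [AddCommGroup M'] [Module R M'] [AddCommGroup F] [Module R F]

namespace TorIndependent

lemma rTensor_injective (h : TorIndependent R M N) {i : M' →ₗ[R] F} {p : F →ₗ[R] M}
    (hi : Function.Injective i) (hip : Function.Exact i p) (hp : Function.Surjective p) :
    Function.Injective (i.rTensor N) := by
  obtain ⟨K, _, _, j, q, hj, hjq, hq⟩ := exists_free_presentation (R := R) N
  exact rTensor_injective_of_lTensor_injective hi hip hp hjq hq
    ((torIndependent_iff hj hjq hq).1 h).1

lemma syzygy_left [Module.Flat R F] (h : TorIndependent R M N) {i : M' →ₗ[R] F} {p : F →ₗ[R] M}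
    (hi : Function.Injective i) (hip : Function.Exact i p) (hp : Function.Surjective p) :
    TorIndependent R M' N := by
  have key (n : ℕ) : ∀ (N : Type u) [AddCommGroup N] [Module R N], TorIndependent R M N →
      TorVanishes R (n + 1) M' N := by
    induction n with
    | zero =>
      intro N _ _ h
      obtain ⟨K, _, _, j, q, hj, hjq, hq⟩ := exists_free_presentation (R := R) N
      rw [torVanishes_one_iff M' hj hjq hq]
      have h' := ((torIndependent_iff hj hjq hq).1 h).2
      have inj := (Module.Flat.lTensor_preserves_injective_linearMap (M := F) j hj).comp
        (h'.rTensor_injective hi hip hp)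
      rw [← LinearMap.coe_comp, LinearMap.lTensor_comp_rTensor,
        ← LinearMap.rTensor_comp_lTensor, LinearMap.coe_comp] at inj
      exact inj.of_comp
    | succ n ih =>
      intro N _ _ h
      obtain ⟨K, _, _, j, q, hj, hjq, hq⟩ := exists_free_presentation (R := R) N
      rw [torVanishes_add_two_iff M' hj hjq hq]
      exact ih _ ((torIndependent_iff hj hjq hq).1 h).2
  intro n hn
  obtain ⟨n, rfl⟩ := Nat.exists_eq_add_of_le' hn
  exact key n N h

/-- Both `Tor_{i+2}(M, N) = 0` and `Tor_{i+2}(N, M) = 0` shift to the syzygy of `M`, which reduces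
symmetry to the balancing of `Tor₁`. -/
lemma symm (h : TorIndependent R M N) : TorIndependent R N M := by
  have key (n : ℕ) : ∀ (M : Type u) [AddCommGroup M] [Module R M], TorIndependent R M N →
      TorVanishes R (n + 1) N M := by
    induction n with
    | zero =>
      intro M _ _ h
      obtain ⟨K, _, _, i, p, hi, hip, hp⟩ := exists_free_presentation (R := R) M
      rw [torVanishes_one_iff N hi hip hp,
        LinearMap.lTensor_inj_iff_rTensor_inj]
      exact h.rTensor_injective hi hip hp
    | succ n ih =>
      intro M _ _ h
      obtain ⟨K, _, _, i, p, hi, hip, hp⟩ := exists_free_presentation (R := R) M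
      rw [torVanishes_add_two_iff N hi hip hp]
      exact ih _ (h.syzygy_left hi hip hp)
  intro n hn
  obtain ⟨n, rfl⟩ := Nat.exists_eq_add_of_le' hn
  exact key n M h

end TorIndependent

/-- If `x` is regular on the cokernel of an injection, the injection stays injective modulo `x`. -/
lemma lTensor_quotient_injective_of_isSMulRegular {A B C : Type*} [AddCommGroup A] [Module R A]
    [AddCommGroup B] [Module R B] [AddCommGroup C] [Module R C] {f : A →ₗ[R] B} {g : B →ₗ[R] C}
    (hf : Function.Injective f) (hfg : Function.Exact f g) {x : R} (hx : IsSMulRegular C x) :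
    Function.Injective (f.lTensor (R ⧸ Ideal.span {x})) := by
  have h := QuotSMulTop.map_first_exact_on_four_term_exact_of_isSMulRegular_last (r := x)
    ((LinearMap.exact_zero_iff_injective R f (R := R)).2 hf) hfg hx
  rw [LinearMap.map_zero (QuotSMulTop.map x)] at h
  replace h := (LinearMap.exact_zero_iff_injective _ _).1 h
  have e := QuotSMulTop.equivQuotTensor_naturality x f
  have h' : Function.Injective (f.lTensor (R ⧸ Ideal.span {x}) ∘ₗ
      (QuotSMulTop.equivQuotTensor x A : QuotSMulTop x A →ₗ[R] _)) := by
    rw [← e]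
    exact (QuotSMulTop.equivQuotTensor x B).injective.comp h
  rw [LinearMap.coe_comp] at h'
  exact (Function.Injective.of_comp_iff' _ (QuotSMulTop.equivQuotTensor x A).bijective).1 h'

/-- Injectivity of `(A ⊗ M) ⊗_A (A ⊗ K) → (A ⊗ M) ⊗_A (A ⊗ G)` may be checked on
`A ⊗ (M ⊗ K) → A ⊗ (M ⊗ G)`. -/
lemma lTensor_baseChange_injective {A : Type*} [CommRing A] [Algebra R A] {K G : Type*}
    [AddCommGroup K] [Module R K] [AddCommGroup G] [Module R G] (f : K →ₗ[R] G)
    (h : Function.Injective ((f.lTensor M).lTensor A)) :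
    Function.Injective ((f.baseChange A).lTensor (A ⊗[R] M)) := by
  let eK := TensorProduct.AlgebraTensorModule.distribBaseChange R A M K
  let eG := TensorProduct.AlgebraTensorModule.distribBaseChange R A M G
  have comm : (f.baseChange A).lTensor (A ⊗[R] M) ∘ₗ eK.toLinearMap =
      eG.toLinearMap ∘ₗ (f.lTensor M).baseChange A := by
    ext m k
    simp [eK, eG]
  have h' : Function.Injective ((f.baseChange A).lTensor (A ⊗[R] M) ∘ₗ eK.toLinearMap) := by
    rw [comm, LinearMap.coe_comp]
    exact eG.injective.comp h
  rw [LinearMap.coe_comp] at h'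
  exact (Function.Injective.of_comp_iff' _ eK.bijective).1 h'

/-- Tor-independence passes to the quotient by an element that is regular on `R`, `M`, `N` and
`M ⊗ N`. If `0 → K → G → N → 0` is a free presentation, then `x` is regular on `K ⊆ G` and on
`M ⊗ K ⊆ M ⊗ G`, so the hypotheses pass from `N` to its syzygy `K`. -/
lemma torIndependent_baseChange_quotient {x : R} (hM : IsSMulRegular M x)
    (hN : IsSMulRegular N x) (hMN : IsSMulRegular (M ⊗[R] N) x)
    (h : TorIndependent R M N) (hR : IsSMulRegular R x) :
    TorIndependent (R ⧸ Ideal.span {x}) ((R ⧸ Ideal.span {x}) ⊗[R] M)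
      ((R ⧸ Ideal.span {x}) ⊗[R] N) := by
  have key (n : ℕ) : ∀ (N : Type u) [AddCommGroup N] [Module R N], TorIndependent R M N →
      IsSMulRegular N x → IsSMulRegular (M ⊗[R] N) x →
      TorVanishes (R ⧸ Ideal.span {x}) (n + 1) ((R ⧸ Ideal.span {x}) ⊗[R] M)
      ((R ⧸ Ideal.span {x}) ⊗[R] N) := by
    induction n with
    | zero =>
      intro N _ _ h hN hMN
      obtain ⟨K, _, _, j, q, hj, hjq, hq⟩ := exists_free_presentation (R := R) N
      obtain ⟨inj, -⟩ := (torIndependent_iff hj hjq hq).1 h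
      rw [torVanishes_one_iff _ (f := j.baseChange (R ⧸ Ideal.span {x}))
        (g := q.baseChange (R ⧸ Ideal.span {x}))
        (lTensor_quotient_injective_of_isSMulRegular hj hjq hN)
        (lTensor_exact _ hjq hq) (LinearMap.lTensor_surjective _ hq)]
      have := lTensor_quotient_injective_of_isSMulRegular inj (lTensor_exact M hjq hq) hMN
      exact lTensor_baseChange_injective _ this
    | succ n ih =>
      intro N _ _ h hN hMN
      obtain ⟨K, _, _, j, q, hj, hjq, hq⟩ := exists_free_presentation (R := R) N
      obtain ⟨inj, h'⟩ := (torIndependent_iff hj hjq hq).1 h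
      rw [torVanishes_add_two_iff _ (f := j.baseChange (R ⧸ Ideal.span {x}))
        (g := q.baseChange (R ⧸ Ideal.span {x}))
        (lTensor_quotient_injective_of_isSMulRegular hj hjq hN)
        (lTensor_exact _ hjq hq) (LinearMap.lTensor_surjective _ hq)]
      have hG : IsSMulRegular (N →₀ R) x := fun a b hab => by
        ext n
        exact hR (DFunLike.congr_fun hab n)
      exact ih _ h' (hG.of_injective j hj) ((hM.rTensor _).of_injective _ inj)
  intro n hn
  obtain ⟨n, rfl⟩ := Nat.exists_eq_add_of_le' hn
  exact key n N h hN hMN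

end TorIndependent

/-! ### Depth -/

open IsLocalRing RingTheory.Sequence

section
variable {R : Type u} [CommRing R] [IsLocalRing R]

/-- The residue field `R ⧸ 𝔪` as an object of `ModuleCat R`; the `Shrink` is the form in which
Mathlib states the Rees theorem. -/
noncomputable abbrev residueModule (R : Type u) [CommRing R] [IsLocalRing R] : ModuleCat.{u} R :=
  ModuleCat.of R (Shrink.{u} (R ⧸ maximalIdeal R))

variable (R) in
lemma exists_ringKrullDim_eq_natCast [IsNoetherianRing R] : ∃ d : ℕ, ringKrullDim R = d := by
  obtain ⟨a, ha⟩ := WithBot.ne_bot_iff_exists.1 (ringKrullDim_ne_bot (R := R))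
  obtain ⟨d, rfl⟩ := ENat.ne_top_iff_exists.1 (show a ≠ ⊤ by
    rintro rfl
    exact ringKrullDim_ne_top (R := R) ha.symm)
  exact ⟨d, ha.symm⟩

lemma moduleDepth_le_ringKrullDim [IsNoetherianRing R] (M : Type*) [AddCommGroup M]
    [Module R M] [Module.Finite R M] : (moduleDepth R M : WithBot ℕ∞) ≤ ringKrullDim R := by
  obtain ⟨d, hd⟩ := exists_ringKrullDim_eq_natCast (R := R)
  rw [hd]
  refine WithBot.coe_le_coe.2 (iSup_le fun rs => iSup_le fun hmem => iSup_le fun hreg => ?_)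
  have h := Module.supportDim_add_length_eq_supportDim_of_isRegular rs hreg
  have hnt := hreg.quot_ofList_smul_nontrivial ⊤
  have h0 : 0 ≤ Module.supportDim R (M ⧸ Ideal.ofList rs • (⊤ : Submodule R M)) :=
    Order.krullDim_nonneg_iff.2 (Module.nonempty_support_of_nontrivial (R := R)).to_subtype
  have h1 : (rs.length : WithBot ℕ∞) ≤ (d : WithBot ℕ∞) := by
    rw [← hd]
    calc (rs.length : WithBot ℕ∞) = 0 + rs.length := (zero_add _).symm
      _ ≤ _ := add_le_add_left h0 _
      _ ≤ _ := h.trans_le (Module.supportDim_le_ringKrullDim R M)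
  exact_mod_cast h1

section
variable [IsNoetherianRing R] {M : Type u} [AddCommGroup M] [Module R M] [Module.Finite R M]
  [Nontrivial M]

lemma exists_isRegular_iff_ext (n : ℕ) :
    (∃ rs : List R, rs.length = n ∧ (∀ r ∈ rs, r ∈ maximalIdeal R) ∧ IsRegular M rs) ↔
      ∀ i < n, Subsingleton (Abelian.Ext (residueModule R) (ModuleCat.of R M) i) := by
  have lt : maximalIdeal R • (⊤ : Submodule R M) < ⊤ :=
    (Submodule.top_ne_ideal_smul_of_le_jacobson_annihilator
      (maximalIdeal_le_jacobson _)).symm.lt_top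
  exact (ModuleCat.exists_isRegular_tfae (maximalIdeal R) n (ModuleCat.of R M) lt).out 3 1

/-- Depth is detected by the vanishing of `Ext(R ⧸ 𝔪, M)`, by the Rees theorem. -/
lemma le_moduleDepth_iff (n : ℕ) :
    (n : ℕ∞) ≤ moduleDepth R M ↔
      ∀ i < n, Subsingleton (Abelian.Ext (residueModule R) (ModuleCat.of R M) i) := by
  constructor
  · intro h i hi
    have : ((i : ℕ) : ℕ∞) < moduleDepth R M := lt_of_lt_of_le (by exact_mod_cast hi) h
    simp only [moduleDepth, lt_iSup_iff] at this
    obtain ⟨rs, hmem, hreg, hlt⟩ := this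
    exact (exists_isRegular_iff_ext rs.length).1 ⟨rs, rfl, hmem, hreg⟩ i (by exact_mod_cast hlt)
  · intro h
    obtain ⟨rs, rfl, hmem, hreg⟩ := (exists_isRegular_iff_ext n).2 h
    exact le_iSup_of_le rs (le_iSup_of_le hmem (le_iSup_of_le hreg le_rfl))

lemma exists_isRegular_of_le_moduleDepth {n : ℕ} (h : (n : ℕ∞) ≤ moduleDepth R M) :
    ∃ rs : List R, rs.length = n ∧ (∀ r ∈ rs, r ∈ maximalIdeal R) ∧ IsRegular M rs :=
  (exists_isRegular_iff_ext n).2 ((le_moduleDepth_iff n).1 h)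

end

section
variable [IsNoetherianRing R] {A B C : Type u} [AddCommGroup A] [Module R A] [AddCommGroup B]
  [Module R B] [AddCommGroup C] [Module R C] [Module.Finite R A] [Module.Finite R B]
  [Module.Finite R C] [Nontrivial A] [Nontrivial B] [Nontrivial C]
  {f : A →ₗ[R] B} {g : B →ₗ[R] C}

lemma le_moduleDepth_left (hf : Function.Injective f) (hfg : Function.Exact f g)
    (hg : Function.Surjective g) {n : ℕ} (hB : ((n + 1 : ℕ) : ℕ∞) ≤ moduleDepth R B)
    (hC : (n : ℕ∞) ≤ moduleDepth R C) : ((n + 1 : ℕ) : ℕ∞) ≤ moduleDepth R A := by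
  rw [le_moduleDepth_iff] at *
  intro i hi
  have hS := shortExact_of_exact hf hfg hg
  refine ⟨fun a b => ?_⟩
  suffices h : ∀ x : Abelian.Ext (residueModule R) (ModuleCat.of R A) i, x = 0 by rw [h a, h b]
  intro x
  have := hB i hi
  match i, x with
  | 0, x =>
    have := hS.mono_f
    exact Abelian.Ext.postcomp_mk₀_injective_of_mono _ (ModuleCat.ofHom f) (Subsingleton.elim _ _)
  | i + 1, x =>
    have := hC i (by omega)
    obtain ⟨y, hy⟩ := Abelian.Ext.covariant_sequence_exact₁ _ hS x (Subsingleton.elim _ _) rfl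
    rw [← hy, Subsingleton.elim y 0, Abelian.Ext.zero_comp]

lemma le_moduleDepth_right (hf : Function.Injective f) (hfg : Function.Exact f g)
    (hg : Function.Surjective g) {n : ℕ} (hA : ((n + 1 : ℕ) : ℕ∞) ≤ moduleDepth R A)
    (hB : (n : ℕ∞) ≤ moduleDepth R B) : (n : ℕ∞) ≤ moduleDepth R C := by
  rw [le_moduleDepth_iff] at *
  intro i hi
  have hS := shortExact_of_exact hf hfg hg
  refine ⟨fun a b => ?_⟩
  suffices h : ∀ x : Abelian.Ext (residueModule R) (ModuleCat.of R C) i, x = 0 by rw [h a, h b]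
  intro x
  have := hB i hi
  have := hA (i + 1) (by omega)
  obtain ⟨y, hy⟩ := Abelian.Ext.covariant_sequence_exact₃ _ hS x rfl (Subsingleton.elim _ _)
  rw [← hy, Subsingleton.elim y 0, Abelian.Ext.zero_comp]

/-- The depth lemma for a short exact sequence `0 → A → B → C → 0`: if `depth C < depth B` then
`depth A = depth C + 1`. -/
lemma moduleDepth_left_eq_add_one (hf : Function.Injective f) (hfg : Function.Exact f g)
    (hg : Function.Surjective g) (h : moduleDepth R C < moduleDepth R B) :
    moduleDepth R A = moduleDepth R C + 1 := by
  obtain ⟨c, hc⟩ := ENat.ne_top_iff_exists.1 (ne_top_of_lt h)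
  rw [← hc] at h ⊢
  have hB : ((c + 1 : ℕ) : ℕ∞) ≤ moduleDepth R B := by
    push_cast
    exact Order.add_one_le_of_lt h
  refine le_antisymm ?_ (le_moduleDepth_left hf hfg hg hB hc.le)
  by_contra! hlt
  have := le_moduleDepth_right hf hfg hg (n := c + 1) ?_ hB
  · rw [← hc, Nat.cast_le] at this
    omega
  · push_cast
    exact Order.add_one_le_of_lt hlt
end

lemma moduleDepth_le_of_forall_isRegular {M N : Type*} [AddCommGroup M] [Module R M]
    [AddCommGroup N] [Module R N]
    (h : ∀ rs : List R, (∀ r ∈ rs, r ∈ maximalIdeal R) → IsRegular M rs → IsRegular N rs) :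
    moduleDepth R M ≤ moduleDepth R N :=
  iSup_le fun rs => iSup_le fun hmem => iSup_le fun hreg =>
    le_iSup_of_le rs (le_iSup_of_le hmem (le_iSup_of_le (h rs hmem hreg) le_rfl))

lemma LinearEquiv.moduleDepth_eq {M N : Type*} [AddCommGroup M]
    [Module R M] [AddCommGroup N] [Module R N] (e : M ≃ₗ[R] N) :
    moduleDepth R M = moduleDepth R N :=
  le_antisymm (moduleDepth_le_of_forall_isRegular fun rs _ h => (e.isRegular_congr rs).1 h)
    (moduleDepth_le_of_forall_isRegular fun rs _ h => (e.isRegular_congr rs).2 h)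

section
variable (M N F : Type*) [AddCommGroup M] [Module R M] [Module.Finite R M]
  [Nontrivial M] [AddCommGroup N] [Module R N] [Module.Finite R N] [Nontrivial N]
  [AddCommGroup F] [Module R F] [Module.Finite R F] [Nontrivial F] [Module.Flat R F]

lemma IsLocalRing.nontrivial_tensorProduct : Nontrivial (M ⊗[R] N) := by
  by_contra h
  rw [not_nontrivial_iff_subsingleton] at h
  have hM : Nontrivial (ResidueField R ⊗[R] M) := by
    by_contra h
    rw [not_nontrivial_iff_subsingleton, subsingleton_tensorProduct] at h
    exact not_subsingleton M h
  have hN : Nontrivial (ResidueField R ⊗[R] N) := by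
    by_contra h
    rw [not_nontrivial_iff_subsingleton, subsingleton_tensorProduct] at h
    exact not_subsingleton N h
  have : Subsingleton (ResidueField R ⊗[R] (M ⊗[R] N)) := subsingleton_tensorProduct.2 h
  have e := TensorProduct.AlgebraTensorModule.distribBaseChange R (ResidueField R) M N
  have := e.symm.injective.subsingleton
  exact not_subsingleton ((ResidueField R ⊗[R] M) ⊗[ResidueField R] (ResidueField R ⊗[R] N)) this

lemma moduleDepth_le_moduleDepth_flat_tensor : moduleDepth R N ≤ moduleDepth R (F ⊗[R] N) := by
  have := nontrivial_tensorProduct (R := R) F N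
  exact moduleDepth_le_of_forall_isRegular fun rs hmem hreg =>
    .of_isWeaklyRegular_of_mem_maximalIdeal _ hmem hreg.1.isWeaklyRegular_lTensor

lemma moduleDepth_self_le_moduleDepth_flat : moduleDepth R R ≤ moduleDepth R F :=
  (moduleDepth_le_moduleDepth_flat_tensor R F).trans_eq (TensorProduct.rid R F).moduleDepth_eq

end

/-- Depth does not depend on the local ring over which it is computed, along surjections. -/
lemma moduleDepth_eq_of_surjective {S : Type*} [CommRing S] [IsLocalRing S] [Algebra R S]
    (hS : Function.Surjective (algebraMap R S)) (M : Type*) [AddCommGroup M] [Module R M]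
    [Module S M] [IsScalarTower R S M] [Module.Finite R M] [Nontrivial M] :
    moduleDepth R M = moduleDepth S M := by
  have : Module.Finite S M := Module.Finite.of_restrictScalars_finite R S M
  have : IsLocalHom (algebraMap R S) := IsLocalHom.of_surjective _ hS
  have hmem (r : R) : algebraMap R S r ∈ maximalIdeal S ↔ r ∈ maximalIdeal R := by
    simp [mem_maximalIdeal, mem_nonunits_iff]
  apply le_antisymm
  · refine iSup_le fun rs => iSup_le fun h => iSup_le fun hreg => ?_
    have h' : ∀ r ∈ rs.map (algebraMap R S), r ∈ maximalIdeal S := by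
      simpa [hmem] using h
    exact le_iSup_of_le (rs.map (algebraMap R S)) (le_iSup_of_le h' (le_iSup_of_le
      (.of_isWeaklyRegular_of_mem_maximalIdeal _ h'
        ((isWeaklyRegular_map_algebraMap_iff S M rs).2 hreg.1)) (by simp)))
  · refine iSup_le fun rs => iSup_le fun h => iSup_le fun hreg => ?_
    obtain ⟨rs, rfl⟩ := List.map_surjective_iff.2 hS rs
    have h' : ∀ r ∈ rs, r ∈ maximalIdeal R := by
      simpa [hmem] using h
    exact le_iSup_of_le rs (le_iSup_of_le h' (le_iSup_of_le
      (.of_isWeaklyRegular_of_mem_maximalIdeal _ h'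
        ((isWeaklyRegular_map_algebraMap_iff S M rs).1 hreg.1)) (by simp)))

lemma isLocalRing_quotient_span_singleton {x : R} (hx : x ∈ maximalIdeal R) :
    IsLocalRing (R ⧸ Ideal.span {x}) := by
  have : Nontrivial (R ⧸ Ideal.span {x}) := Ideal.Quotient.nontrivial_iff.2 fun h =>
    (maximalIdeal.isMaximal R).ne_top (top_le_iff.1 (h ▸ (Ideal.span_singleton_le_iff_mem _).2 hx))
  exact .of_surjective' _ Ideal.Quotient.mk_surjective

section
variable [IsNoetherianRing R] (M : Type u) [AddCommGroup M] [Module R M] [Module.Finite R M]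
  [Nontrivial M] {x : R}

variable {M} in
lemma moduleDepth_eq_moduleDepth_quotSMulTop_add_one (hx : x ∈ maximalIdeal R)
    (hreg : IsSMulRegular M x) : moduleDepth R M = moduleDepth R (QuotSMulTop x M) + 1 := by
  have := nontrivial_quotSMulTop_of_mem_maximalIdeal M hx
  have key (n : ℕ) : ((n + 1 : ℕ) : ℕ∞) ≤ moduleDepth R M ↔
      (n : ℕ∞) ≤ moduleDepth R (QuotSMulTop x M) := by
    constructor
    · intro h
      exact le_moduleDepth_right (f := LinearMap.lsmul R M x) hreg
        (LinearMap.exact_lsmul_mkQ_smul_top M x)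
        (Submodule.mkQ_surjective _) h ((Nat.cast_le.2 n.le_succ).trans h)
    · intro h
      obtain ⟨rs, rfl, hmem, h⟩ := exists_isRegular_of_le_moduleDepth h
      refine le_iSup_of_le (x :: rs) (le_iSup_of_le (List.forall_mem_cons.2 ⟨hx, hmem⟩)
        (le_iSup_of_le (.cons hreg h) (by simp)))
  refine ENat.eq_of_forall_natCast_le_iff fun n => ?_
  cases n with
  | zero => simp
  | succ n =>
    rw [key]
    push_cast
    exact (ENat.add_le_add_iff_right ENat.one_ne_top).symm

variable {M} in
lemma moduleDepth_eq_moduleDepth_quotient_tensor_add_one [IsLocalRing (R ⧸ Ideal.span {x})]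
    (hx : x ∈ maximalIdeal R) (hreg : IsSMulRegular M x) :
    moduleDepth R M =
      moduleDepth (R ⧸ Ideal.span {x}) ((R ⧸ Ideal.span {x}) ⊗[R] M) + 1 := by
  have := nontrivial_quotSMulTop_of_mem_maximalIdeal M hx
  have := (QuotSMulTop.equivQuotTensor x M).symm.surjective.nontrivial
  rw [moduleDepth_eq_moduleDepth_quotSMulTop_add_one hx hreg,
    (QuotSMulTop.equivQuotTensor x M).moduleDepth_eq,
    moduleDepth_eq_of_surjective (S := R ⧸ Ideal.span {x}) Ideal.Quotient.mk_surjective]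

end

end

section
variable {R : Type u} [CommRing R] [IsLocalRing R]

lemma subsingleton_linearMap_residue_of_moduleDepth_ne_zero {M : Type*} [AddCommGroup M]
    [Module R M] (h : moduleDepth R M ≠ 0) :
    Subsingleton ((R ⧸ maximalIdeal R) →ₗ[R] M) := by
  rw [← pos_iff_ne_zero] at h
  simp only [moduleDepth, lt_iSup_iff] at h
  obtain ⟨rs, hmem, hreg, hlt⟩ := h
  match rs with
  | [] => simp at hlt
  | x :: rs =>
    refine IsSMulRegular.linearMap_subsingleton_of_mem_annihilator
      ((isRegular_cons_iff M x rs).1 hreg).1 ?_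
    rw [Ideal.annihilator_quotient]
    exact hmem x List.mem_cons_self

lemma moduleDepth_ne_zero_of_injective [IsNoetherianRing R] {M N : Type u} [AddCommGroup M]
    [Module R M] [Module.Finite R M] [Nontrivial M] [AddCommGroup N] [Module R N]
    {f : M →ₗ[R] N} (hf : Function.Injective f) (h : moduleDepth R N ≠ 0) :
    moduleDepth R M ≠ 0 := by
  have := subsingleton_linearMap_residue_of_moduleDepth_ne_zero h
  have hM : Subsingleton ((R ⧸ maximalIdeal R) →ₗ[R] M) :=
    ⟨fun a b => LinearMap.ext fun y =>
      hf (LinearMap.congr_fun (Subsingleton.elim (f ∘ₗ a) (f ∘ₗ b)) y)⟩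
  obtain ⟨x, hx, hreg⟩ := IsSMulRegular.subsingleton_linearMap_iff.1 hM
  rw [Ideal.annihilator_quotient] at hx
  rw [moduleDepth_eq_moduleDepth_quotSMulTop_add_one hx hreg]
  simp

omit [IsLocalRing R] in
lemma subsingleton_linearMap_prod {K A B : Type*} [AddCommGroup K] [Module R K] [AddCommGroup A]
    [Module R A] [AddCommGroup B] [Module R B] [Subsingleton (K →ₗ[R] A)]
    [Subsingleton (K →ₗ[R] B)] : Subsingleton (K →ₗ[R] A × B) :=
  ⟨fun a b => LinearMap.ext fun y => Prod.ext
    (LinearMap.congr_fun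
      (Subsingleton.elim (LinearMap.fst R A B ∘ₗ a) (LinearMap.fst R A B ∘ₗ b)) y)
    (LinearMap.congr_fun
      (Subsingleton.elim (LinearMap.snd R A B ∘ₗ a) (LinearMap.snd R A B ∘ₗ b)) y)⟩

lemma exists_isSMulRegular_of_moduleDepth_ne_zero [IsNoetherianRing R] {A B C D : Type*}
    [AddCommGroup A] [Module R A] [Module.Finite R A] [AddCommGroup B] [Module R B]
    [Module.Finite R B] [AddCommGroup C] [Module R C] [Module.Finite R C] [AddCommGroup D]
    [Module R D] [Module.Finite R D] (hA : moduleDepth R A ≠ 0) (hB : moduleDepth R B ≠ 0)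
    (hC : moduleDepth R C ≠ 0) (hD : moduleDepth R D ≠ 0) :
    ∃ x ∈ maximalIdeal R, IsSMulRegular A x ∧ IsSMulRegular B x ∧ IsSMulRegular C x ∧
      IsSMulRegular D x := by
  have := subsingleton_linearMap_residue_of_moduleDepth_ne_zero hA
  have := subsingleton_linearMap_residue_of_moduleDepth_ne_zero hB
  have := subsingleton_linearMap_residue_of_moduleDepth_ne_zero hC
  have := subsingleton_linearMap_residue_of_moduleDepth_ne_zero hD
  have := subsingleton_linearMap_prod (R := R) (K := R ⧸ maximalIdeal R) (A := C) (B := D)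
  have := subsingleton_linearMap_prod (R := R) (K := R ⧸ maximalIdeal R) (A := B) (B := C × D)
  have := subsingleton_linearMap_prod (R := R) (K := R ⧸ maximalIdeal R) (A := A) (B := B × C × D)
  obtain ⟨x, hx, hreg⟩ := IsSMulRegular.subsingleton_linearMap_iff.1 this
  rw [Ideal.annihilator_quotient] at hx
  have h₁ := hreg.of_injective (LinearMap.inr R A (B × C × D)) LinearMap.inr_injective
  have h₂ := h₁.of_injective (LinearMap.inr R B (C × D)) LinearMap.inr_injective
  exact ⟨x, hx, hreg.of_injective (LinearMap.inl R A _) LinearMap.inl_injective,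
    h₁.of_injective (LinearMap.inl R B _) LinearMap.inl_injective,
    h₂.of_injective (LinearMap.inl R C _) LinearMap.inl_injective,
    h₂.of_injective (LinearMap.inr R C _) LinearMap.inr_injective⟩

/-! ### The depth formula over Cohen-Macaulay local rings -/

omit [IsLocalRing R] in
lemma exists_finite_free_presentation [IsNoetherianRing R] (M : Type u) [AddCommGroup M]
    [Module R M] [Module.Finite R M] [Nontrivial M] :
    ∃ (K F : Type u) (_ : AddCommGroup K) (_ : Module R K) (_ : AddCommGroup F) (_ : Module R F)
      (i : K →ₗ[R] F) (p : F →ₗ[R] M), Module.Finite R K ∧ Module.Finite R F ∧ Module.Free R F ∧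
      Nontrivial F ∧ Function.Injective i ∧ Function.Exact i p ∧ Function.Surjective p := by
  obtain ⟨n, p, hp⟩ := Module.Finite.exists_fin' R M
  exact ⟨LinearMap.ker p, Fin n → R, inferInstance, inferInstance, inferInstance, inferInstance,
    (LinearMap.ker p).subtype, p, inferInstance, inferInstance, inferInstance, hp.nontrivial,
    Submodule.subtype_injective _, LinearMap.exact_subtype_ker_map _, hp⟩

omit [IsLocalRing R] in
lemma linearEquiv_of_subsingleton_left {K F M : Type*} [AddCommGroup K] [Module R K]
    [AddCommGroup F] [Module R F] [AddCommGroup M] [Module R M] [Subsingleton K]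
    {i : K →ₗ[R] F} {p : F →ₗ[R] M} (hip : Function.Exact i p) (hp : Function.Surjective p) :
    Nonempty (F ≃ₗ[R] M) := by
  refine ⟨LinearEquiv.ofBijective p ⟨(injective_iff_map_eq_zero p).2 fun y hy => ?_, hp⟩⟩
  obtain ⟨k, rfl⟩ := (hip y).1 hy
  rw [Subsingleton.elim k 0, map_zero]

lemma IsCohenMacaulayLocalRing.quotient (hR : IsCohenMacaulayLocalRing R) {x : R}
    [IsLocalRing (R ⧸ Ideal.span {x})] (hx : x ∈ maximalIdeal R) (hreg : IsSMulRegular R x) :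
    IsCohenMacaulayLocalRing (R ⧸ Ideal.span {x}) := by
  have := hR.isNoetherianRing
  refine ⟨inferInstance, ?_⟩
  have h₁ := moduleDepth_eq_moduleDepth_quotient_tensor_add_one hx hreg
  rw [(TensorProduct.AlgebraTensorModule.rid R (R ⧸ Ideal.span {x})
    (R ⧸ Ideal.span {x})).moduleDepth_eq] at h₁
  have h₂ := ringKrullDim_quotient_span_singleton_succ_eq_ringKrullDim hreg hx
  obtain ⟨d, hd⟩ := exists_ringKrullDim_eq_natCast (R := R ⧸ Ideal.span {x})
  have h₃ := hR.depth_eq_dim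
  rw [h₁, ← h₂, hd] at h₃
  rw [hd]
  have h₄ : moduleDepth (R ⧸ Ideal.span {x}) (R ⧸ Ideal.span {x}) + 1 = (d : ℕ∞) + 1 :=
    WithBot.coe_injective h₃
  have h₅ : moduleDepth (R ⧸ Ideal.span {x}) (R ⧸ Ideal.span {x}) = d :=
    le_antisymm ((ENat.add_le_add_iff_right ENat.one_ne_top).1 h₄.le)
      ((ENat.add_le_add_iff_right ENat.one_ne_top).1 h₄.ge)
  rw [h₅]
  rfl

/-- If `x` is regular on `R`, `M`, `N` and `M ⊗ N`, all four depths drop by one modulo `x`, so the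
depth formula lifts from `R ⧸ (x)` to `R`. -/
lemma SatisfiesDepthFormula.of_isSMulRegular [IsNoetherianRing R] {M N : Type u} [AddCommGroup M]
    [Module R M] [Module.Finite R M] [Nontrivial M] [AddCommGroup N] [Module R N]
    [Module.Finite R N] [Nontrivial N] {x : R} [IsLocalRing (R ⧸ Ideal.span {x})]
    (hx : x ∈ maximalIdeal R) (hR : IsSMulRegular R x) (hM : IsSMulRegular M x)
    (hN : IsSMulRegular N x) (hMN : IsSMulRegular (M ⊗[R] N) x) (h : TorIndependent R M N)
    (hquot : DepthFormulaHoldsOver (R ⧸ Ideal.span {x})) : SatisfiesDepthFormula R M N := by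
  have := nontrivial_tensorProduct (R := R) M N
  have nt (L : Type u) [AddCommGroup L] [Module R L] [Module.Finite R L] [Nontrivial L] :
      Nontrivial ((R ⧸ Ideal.span {x}) ⊗[R] L) :=
    have := nontrivial_quotSMulTop_of_mem_maximalIdeal L hx
    (QuotSMulTop.equivQuotTensor x L).symm.surjective.nontrivial
  have key := hquot ((R ⧸ Ideal.span {x}) ⊗[R] M) ((R ⧸ Ideal.span {x}) ⊗[R] N)
    inferInstance inferInstance (nt M) (nt N) (torIndependent_baseChange_quotient hM hN hMN h hR)
  have e := LinearEquiv.moduleDepth_eq (R := R ⧸ Ideal.span {x})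
    (M := (R ⧸ Ideal.span {x}) ⊗[R] (M ⊗[R] N))
    (N := ((R ⧸ Ideal.span {x}) ⊗[R] M) ⊗[R ⧸ Ideal.span {x}] ((R ⧸ Ideal.span {x}) ⊗[R] N))
    (TensorProduct.AlgebraTensorModule.distribBaseChange R (R ⧸ Ideal.span {x}) M N)
  rw [SatisfiesDepthFormula, ← e] at key
  rw [SatisfiesDepthFormula, moduleDepth_eq_moduleDepth_quotient_tensor_add_one hx hM,
    moduleDepth_eq_moduleDepth_quotient_tensor_add_one hx hN,
    moduleDepth_eq_moduleDepth_quotient_tensor_add_one hx hMN,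
    moduleDepth_eq_moduleDepth_quotient_tensor_add_one hx hR,
    (TensorProduct.AlgebraTensorModule.rid R (R ⧸ Ideal.span {x})
    (R ⧸ Ideal.span {x})).moduleDepth_eq, add_add_add_comm, key, add_add_add_comm]

lemma SatisfiesDepthFormula.symm {M N : Type u} [AddCommGroup M]
    [Module R M] [AddCommGroup N] [Module R N] (h : SatisfiesDepthFormula R M N) :
    SatisfiesDepthFormula R N M := by
  rw [SatisfiesDepthFormula, add_comm, h, (TensorProduct.comm R M N).moduleDepth_eq]

section
variable (hR : IsCohenMacaulayLocalRing R) {d : ℕ} (hd : ringKrullDim R = d)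
include hR hd

lemma IsCohenMacaulayLocalRing.moduleDepth_self : moduleDepth R R = d := by
  have := hR.depth_eq_dim
  rw [hd] at this
  exact WithBot.coe_injective this

lemma IsCohenMacaulayLocalRing.exists_moduleDepth_eq (M : Type u) [AddCommGroup M] [Module R M]
    [Module.Finite R M] : ∃ m : ℕ, moduleDepth R M = m ∧ m ≤ d := by
  have := hR.isNoetherianRing
  have h := moduleDepth_le_ringKrullDim (R := R) M
  rw [hd] at h
  have h' : moduleDepth R M ≤ d := WithBot.coe_le_coe.1 h
  obtain ⟨m, hm⟩ := ENat.ne_top_iff_exists.1 (ne_top_of_le_ne_top (ENat.natCast_ne_top d) h')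
  exact ⟨m, hm.symm, by rw [← hm] at h'; exact_mod_cast h'⟩

-- The inductive hypothesis: the formula holds over every quotient by a regular element.
variable (hquot : ∀ x ∈ maximalIdeal R, ∀ _ : IsLocalRing (R ⧸ Ideal.span {x}),
  IsSMulRegular R x → DepthFormulaHoldsOver (R ⧸ Ideal.span {x}))
variable {M N : Type u} [AddCommGroup M] [Module R M] [Module.Finite R M] [Nontrivial M]
  [AddCommGroup N] [Module R N] [Module.Finite R N] [Nontrivial N]
include hquot

lemma satisfiesDepthFormula_of_moduleDepth_tensor_ne_zero (hd₀ : d ≠ 0)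
    (hM : moduleDepth R M ≠ 0) (hN : moduleDepth R N ≠ 0) (hMN : moduleDepth R (M ⊗[R] N) ≠ 0)
    (h : TorIndependent R M N) : SatisfiesDepthFormula R M N := by
  have := hR.isNoetherianRing
  have hR₀ : moduleDepth R R ≠ 0 := by
    rw [hR.moduleDepth_self hd]
    exact_mod_cast hd₀
  obtain ⟨x, hx, h₁, h₂, h₃, h₄⟩ := exists_isSMulRegular_of_moduleDepth_ne_zero hR₀ hM hN hMN
  have loc := isLocalRing_quotient_span_singleton hx
  exact .of_isSMulRegular hx h₁ h₂ h₃ h₄ h (hquot x hx loc h₁)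

/-- If `depth N > 0 = depth (M ⊗ N)`, the formula for the first syzygy `K` of `M` reads
`depth K + depth N = d + 1`, because `K ⊗ N ⊆ F ⊗ N` has depth exactly one. As
`depth K = depth M + 1` when `depth M < d` and `depth K = d` when `depth M = d`, the formula for `M`
follows in the first case, and `depth N = 1` in the second. -/
lemma moduleDepth_add_of_moduleDepth_tensor_eq_zero (hd₀ : d ≠ 0)
    (hN : moduleDepth R N ≠ 0) (hMN : moduleDepth R (M ⊗[R] N) = 0)
    (h : TorIndependent R M N) :
    (moduleDepth R M < d → moduleDepth R M + moduleDepth R N = d) ∧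
      (moduleDepth R M = d → moduleDepth R N = 1) := by
  have := hR.isNoetherianRing
  obtain ⟨K, F, _, _, _, _, i, p, _, _, _, _, hi, hip, hp⟩ :=
    exists_finite_free_presentation (R := R) M
  have := nontrivial_tensorProduct (R := R) M N
  have := nontrivial_tensorProduct (R := R) F N
  have hFN := moduleDepth_le_moduleDepth_flat_tensor (R := R) N F
  have hF := moduleDepth_self_le_moduleDepth_flat (R := R) F
  rw [hR.moduleDepth_self hd] at hF
  have hFN₀ : moduleDepth R (F ⊗[R] N) ≠ 0 := by
    rw [← pos_iff_ne_zero] at hN ⊢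
    exact hN.trans_le hFN
  have : Nontrivial K := by
    by_contra hK
    rw [not_nontrivial_iff_subsingleton] at hK
    obtain ⟨e⟩ := linearEquiv_of_subsingleton_left hip hp
    exact hFN₀ ((e.rTensor N).moduleDepth_eq.trans hMN)
  have := nontrivial_tensorProduct (R := R) K N
  have inj := h.rTensor_injective hi hip hp
  have hKN : moduleDepth R (K ⊗[R] N) = 1 := by
    rw [moduleDepth_left_eq_add_one inj (rTensor_exact N hip hp) (LinearMap.rTensor_surjective N hp)
      (by rw [hMN]; exact pos_iff_ne_zero.2 hFN₀), hMN, zero_add]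
  have hK : moduleDepth R K ≠ 0 := moduleDepth_ne_zero_of_injective hi (by
    rw [← pos_iff_ne_zero]
    exact (by exact_mod_cast pos_iff_ne_zero.2 hd₀ : (0 : ℕ∞) < d).trans_le hF)
  have key := satisfiesDepthFormula_of_moduleDepth_tensor_ne_zero hR hd hquot hd₀ hK hN
    (by simp [hKN]) (h.syzygy_left hi hip hp)
  rw [SatisfiesDepthFormula, hKN, hR.moduleDepth_self hd] at key
  obtain ⟨m, hm, hmd⟩ := hR.exists_moduleDepth_eq hd M
  obtain ⟨n, hn, -⟩ := hR.exists_moduleDepth_eq hd N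
  obtain ⟨k, hk, hkd⟩ := hR.exists_moduleDepth_eq hd K
  rw [hn] at key hN
  rw [hk] at key
  constructor
  · intro hlt
    rw [moduleDepth_left_eq_add_one hi hip hp (hlt.trans_le hF), hm] at hk
    rw [hm, hn]
    norm_cast at *
    omega
  · intro heq
    rw [hn]
    have hdk : (d : ℕ∞) ≤ moduleDepth R K := by
      obtain ⟨c, rfl⟩ := Nat.exists_eq_succ_of_ne_zero hd₀
      exact le_moduleDepth_left hi hip hp hF
        ((Nat.cast_le.2 c.le_succ).trans heq.ge)
    rw [hk] at hdk
    norm_cast at *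
    omega

/-- When `depth (M ⊗ N) = 0`, the one-sided statement settles the formula unless `depth M = d`. In
that case `depth N = 1 < d`, and it applies with the roles of `M` and `N` exchanged. -/
lemma satisfiesDepthFormula_of_moduleDepth_ne_zero (hd₂ : 2 ≤ d)
    (hM : moduleDepth R M ≠ 0) (hN : moduleDepth R N ≠ 0)
    (h : TorIndependent R M N) : SatisfiesDepthFormula R M N := by
  have hd₀ : d ≠ 0 := by omega
  by_cases hMN : moduleDepth R (M ⊗[R] N) = 0
  · obtain ⟨m, hm, hmd⟩ := hR.exists_moduleDepth_eq hd M
    rw [SatisfiesDepthFormula, hR.moduleDepth_self hd, hMN, add_zero]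
    obtain ⟨h₁, h₂⟩ := moduleDepth_add_of_moduleDepth_tensor_eq_zero hR hd hquot hd₀ hN hMN h
    rcases hmd.lt_or_eq with hlt | rfl
    · exact h₁ (by rw [hm]; exact_mod_cast hlt)
    · have hN₁ := h₂ hm
      rw [add_comm]
      refine (moduleDepth_add_of_moduleDepth_tensor_eq_zero hR hd hquot hd₀ hM
        ((TensorProduct.comm R N M).moduleDepth_eq.trans hMN) h.symm).1 ?_
      rw [hN₁]
      exact_mod_cast hd₂
  · exact satisfiesDepthFormula_of_moduleDepth_tensor_ne_zero hR hd hquot hd₀ hM hN hMN h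

/-- For `depth M > 0 = depth N`, the formula for `M` and the first syzygy `K` of `N`, which has
depth one, reads `depth M + 1 = d + depth (M ⊗ K)`. Here `depth (M ⊗ K) > 0` since
`M ⊗ K ⊆ M ⊗ G`. -/
lemma moduleDepth_eq_of_moduleDepth_eq_zero_right (hd₂ : 2 ≤ d)
    (hM : moduleDepth R M ≠ 0) (hN : moduleDepth R N = 0)
    (h : TorIndependent R M N) : moduleDepth R M = d ∧ moduleDepth R (M ⊗[R] N) = 0 := by
  have := hR.isNoetherianRing
  obtain ⟨K, G, _, _, _, _, j, q, _, _, _, _, hj, hjq, hq⟩ :=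
    exists_finite_free_presentation (R := R) N
  have := nontrivial_tensorProduct (R := R) M N
  have := nontrivial_tensorProduct (R := R) M G
  have hMG := (moduleDepth_le_moduleDepth_flat_tensor (R := R) M G).trans_eq
    (TensorProduct.comm R G M).moduleDepth_eq
  have hG := moduleDepth_self_le_moduleDepth_flat (R := R) G
  rw [hR.moduleDepth_self hd] at hG
  have hG₀ : 0 < moduleDepth R G := (by exact_mod_cast (by omega) : (0 : ℕ∞) < d).trans_le hG
  have hMG₀ : moduleDepth R (M ⊗[R] G) ≠ 0 := by
    rw [← pos_iff_ne_zero] at hM ⊢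
    exact hM.trans_le hMG
  have : Nontrivial K := by
    by_contra hK
    rw [not_nontrivial_iff_subsingleton] at hK
    obtain ⟨e⟩ := linearEquiv_of_subsingleton_left hjq hq
    exact hG₀.ne' (e.moduleDepth_eq.trans hN)
  have := nontrivial_tensorProduct (R := R) M K
  obtain ⟨inj, hMK⟩ := (torIndependent_iff hj hjq hq).1 h
  have hK : moduleDepth R K = 1 := by
    rw [moduleDepth_left_eq_add_one hj hjq hq (by rwa [hN]), hN, zero_add]
  have hMK₀ := moduleDepth_ne_zero_of_injective inj hMG₀
  have key := satisfiesDepthFormula_of_moduleDepth_ne_zero hR hd hquot hd₂ hM (by simp [hK]) hMK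
  rw [SatisfiesDepthFormula, hK, hR.moduleDepth_self hd] at key
  obtain ⟨m, hm, hmd⟩ := hR.exists_moduleDepth_eq hd M
  obtain ⟨t, ht, -⟩ := hR.exists_moduleDepth_eq hd (M ⊗[R] K)
  obtain ⟨s, hs, -⟩ := hR.exists_moduleDepth_eq hd (M ⊗[R] N)
  rw [ht] at hMK₀ key
  rw [hm] at key
  norm_cast at key hMK₀
  obtain rfl : m = d := by omega
  refine ⟨hm, ?_⟩
  -- Otherwise `depth (M ⊗ N) ≥ 1` and `depth (M ⊗ G) ≥ d ≥ 2` would give `depth (M ⊗ K) ≥ 2`.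
  by_contra hs₀
  have h2 := le_moduleDepth_left (n := 1) inj (lTensor_exact M hjq hq)
    (LinearMap.lTensor_surjective M hq) ((Nat.cast_le.2 hd₂).trans (hm.ge.trans hMG)) (by
      rw [hs] at hs₀ ⊢
      norm_cast at hs₀ ⊢
      omega)
  rw [ht] at h2
  norm_cast at h2
  omega

/-- Two Tor-independent modules cannot both have depth zero: otherwise the first syzygy of one of
them has depth one, while the mixed case forces it to have depth `d ≥ 2`. -/
lemma satisfiesDepthFormula_of_two_le (hd₂ : 2 ≤ d) (h : TorIndependent R M N) :
    SatisfiesDepthFormula R M N := by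
  have := hR.isNoetherianRing
  have mixed {M N : Type u} [AddCommGroup M] [Module R M] [Module.Finite R M] [Nontrivial M]
      [AddCommGroup N] [Module R N] [Module.Finite R N] [Nontrivial N] (h : TorIndependent R M N)
      (hM : moduleDepth R M ≠ 0) (hN : moduleDepth R N = 0) : SatisfiesDepthFormula R M N := by
    obtain ⟨h₁, h₂⟩ := moduleDepth_eq_of_moduleDepth_eq_zero_right hR hd hquot hd₂ hM hN h
    rw [SatisfiesDepthFormula, h₁, h₂, hN, hR.moduleDepth_self hd]
  by_cases hM : moduleDepth R M = 0 <;> by_cases hN : moduleDepth R N = 0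
  · obtain ⟨K, F, _, _, _, _, i, p, _, _, _, _, hi, hip, hp⟩ :=
      exists_finite_free_presentation (R := R) M
    have hF := moduleDepth_self_le_moduleDepth_flat (R := R) F
    rw [hR.moduleDepth_self hd] at hF
    have hF₀ : 0 < moduleDepth R F := (by exact_mod_cast (by omega) : (0 : ℕ∞) < d).trans_le hF
    have : Nontrivial K := by
      by_contra hK
      rw [not_nontrivial_iff_subsingleton] at hK
      obtain ⟨e⟩ := linearEquiv_of_subsingleton_left hip hp
      exact hF₀.ne' (e.moduleDepth_eq.trans hM)
    have hK : moduleDepth R K = 1 := by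
      rw [moduleDepth_left_eq_add_one hi hip hp (by rwa [hM]), hM, zero_add]
    have := (moduleDepth_eq_of_moduleDepth_eq_zero_right hR hd hquot hd₂ (by simp [hK]) hN
      (h.syzygy_left hi hip hp)).1
    rw [hK] at this
    norm_cast at this
    omega
  · exact (mixed h.symm hN hM).symm
  · exact mixed h hM hN
  · exact satisfiesDepthFormula_of_moduleDepth_ne_zero hR hd hquot hd₂ hM hN h

end

end

theorem theorem1
    (hdim1 : ∀ (R : Type u) [CommRing R] [IsLocalRing R],
      IsCohenMacaulayLocalRing R → ringKrullDim R = 1 → DepthFormulaHoldsOver R) :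
    ∀ (R : Type u) [CommRing R] [IsLocalRing R],
      IsCohenMacaulayLocalRing R → DepthFormulaHoldsOver R := by
  suffices key : ∀ (d : ℕ) (R : Type u) [CommRing R] [IsLocalRing R],
      IsCohenMacaulayLocalRing R → ringKrullDim R = d → DepthFormulaHoldsOver R by
    intro R _ _ hR
    have := hR.isNoetherianRing
    obtain ⟨d, hd⟩ := exists_ringKrullDim_eq_natCast (R := R)
    exact key d R hR hd
  intro d
  induction d with
  | zero =>
    intro R _ _ hR hd M N _ _ _ _ _ _ _ _ _
    have h₀ (L : Type u) [AddCommGroup L] [Module R L] [Module.Finite R L] :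
        moduleDepth R L = 0 := by
      obtain ⟨m, hm, hmd⟩ := hR.exists_moduleDepth_eq hd L
      rw [hm, Nat.le_zero.1 hmd, Nat.cast_zero]
    rw [SatisfiesDepthFormula, h₀, h₀, h₀, h₀]
  | succ d ih =>
    intro R _ _ hR hd
    rcases Nat.eq_zero_or_pos d with rfl | hpos
    · exact hdim1 R hR (by simpa using hd)
    intro M N _ _ _ _ _ _ _ _ h
    have := hR.isNoetherianRing
    refine satisfiesDepthFormula_of_two_le hR hd (fun x hx _ hreg => ?_) (by omega) h
    refine ih _ (hR.quotient hx hreg) ?_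
    have hdim := ringKrullDim_quotient_span_singleton_succ_eq_ringKrullDim hreg hx
    obtain ⟨e, he⟩ := exists_ringKrullDim_eq_natCast (R := R ⧸ Ideal.span {x})
    rw [hd, he] at hdim
    rw [he]
    norm_cast at hdim ⊢
    omega
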